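/- All graphs are finite and simple, and all colorings are edge colorings. A copy of a graph is a (not necessarily induced) subgraph isomorphic to it; it is rainbow if its edges have pairwise different colors, and monochromatic if all its edges have one color. For a graph $H$ and a positive integer $k$, let $R_k(H)$ be the minimum integer $n$ such that every coloring of $K_n$ using at most $k$ colors contains a monochromatic copy of $H$. For graphs $G$ and $H$, let $gr_k(G : H)$ be the minimum integer $n$ such that every coloring of $K_n$ using at most $k$ colors contains a rainbow copy of $G$ or a monochromatic copy of $H$. Let $P_5$ be the path on $5$ vertices, $K_3$ the triangle, $C_5$ the cycle on $5$ vertices, and $mH$ the disjoint union of $m$ copies of $H$. Then for all integers $m \ge 2$ and $k \ge 3$ these numbers exist for $H = mK_3$ and $H = mC_5$, and 1. $gr_k(P_5 : mK_3) = R_3(mK_3)$; 2. $gr_k(P_5 : mC_5) = R_3(mC_5)$. -/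

import Mathlib

namespace GallaiRamsey

open SimpleGraph

/-- The disjoint union `mH` of `m` copies of the graph `H`. -/
def disjointCopies {V : Type*} (m : ℕ) (H : SimpleGraph V) : SimpleGraph (Fin m × V) where
  Adj x y := x.1 = y.1 ∧ H.Adj x.2 y.2
  symm := ⟨fun _ _ h => ⟨h.1.symm, h.2.symm⟩⟩
  loopless := ⟨fun x h => H.loopless.irrefl x.2 h.2⟩

/-- The edge-colored complete graph on `V` contains a monochromatic copy of `H`
(as a not necessarily induced subgraph). -/
def HasMonochromaticCopy {V W K : Type*} (C : TopEdgeLabeling V K) (H : SimpleGraph W) : Prop :=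
  ∃ c : K, H.IsContained (C.labelGraph c)

/-- The edge-colored complete graph on `V` contains a rainbow copy of `G`: a copy of `G` whose
edges have pairwise different colors. -/
def HasRainbowCopy {V W K : Type*} (C : TopEdgeLabeling V K) (G : SimpleGraph W) : Prop :=
  ∃ f : Copy G (⊤ : SimpleGraph V),
    Function.Injective fun e : G.edgeSet => C (f.toHom.mapEdgeSet e)

/-- The orders `n` such that every coloring of the edges of `K_n` using at most `k` colors
contains a monochromatic copy of `H`. -/
def ramseySet {W : Type*} (k : ℕ) (H : SimpleGraph W) : Set ℕ :=
  {n | ∀ C : TopEdgeLabeling (Fin n) (Fin k), HasMonochromaticCopy C H}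

/-- The `k`-color Ramsey number `R_k(H)`, the minimum of `ramseySet k H`. -/
noncomputable def ramseyNumber {W : Type*} (k : ℕ) (H : SimpleGraph W) : ℕ :=
  sInf (ramseySet k H)

/-- The orders `n` such that every coloring of the edges of `K_n` using at most `k` colors
contains a rainbow copy of `G` or a monochromatic copy of `H`. -/
def gallaiRamseySet {W W' : Type*} (k : ℕ) (G : SimpleGraph W) (H : SimpleGraph W') : Set ℕ :=
  {n | ∀ C : TopEdgeLabeling (Fin n) (Fin k), HasRainbowCopy C G ∨ HasMonochromaticCopy C H}

/-- The Gallai-Ramsey number `gr_k(G : H)`, the minimum of `gallaiRamseySet k G H`. -/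
noncomputable def gallaiRamseyNumber {W W' : Type*} (k : ℕ) (G : SimpleGraph W)
    (H : SimpleGraph W') : ℕ :=
  sInf (gallaiRamseySet k G H)

end GallaiRamsey

/-! The two numbers agree because the sets of admissible orders agree
(`gallaiRamseySet_eq_ramseySet`). A 3-coloring, seen as a k-coloring, has no rainbow P_5, since P_5
has four edges; this is one inclusion. For the other, take n in `ramseySet 3` and a coloring of K_n
without rainbow P_5. If at most three colors occur, relabel them. Otherwise, either all edges
outside some five vertices have one color, and that clique contains mH, or no connected graph with
four edges is rainbow (`connectedRainbowFree_or_nearlyMonochromatic`). In the latter case a color D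
dominates: the vertices split into parts indexed by colors, with D between parts and only D and the
index color inside a part (`ConnectedRainbowFree.exists_partition`).

Of H only `IsBalancedTripartite` matters, with a = 1 for the triangle and a = 2 for C_5. A nested
3-coloring shows n ≥ m(4a+3) - 2 (`le_card_of_isThreeRamsey`). If the parts can be grouped into
three classes of sizes at least ma, ma and m, color D contains mH. Otherwise one part misses fewer
than m(2a+1) vertices, or two parts together miss fewer than m. Then the vertices are recolored with
three colors, and the monochromatic mH supplied by the Ramsey hypothesis is carried back to the
original coloring (`exists_isContained_of_one_large_part`, `exists_isContained_of_two_large_parts`,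
`disjointCopies_isContained_of_replace`). -/

namespace GallaiRamsey

open SimpleGraph

/-! ### Excluding rainbow connected graphs with four edges. -/

section Structure

variable {V K : Type*}

/-- No path on five vertices has four edges of pairwise different colors. -/
def RainbowPathFree (c : V → V → K) : Prop :=
  ∀ x₁ x₂ x₃ x₄ x₅, [x₁, x₂, x₃, x₄, x₅].Nodup → ¬ [c x₁ x₂, c x₂ x₃, c x₃ x₄, c x₄ x₅].Nodup

/-- A rainbow star with leaves `p`, `q`, `r` at `v`, one of whose edges is extended to `s`. -/
def RainbowChair (c : V → V → K) (v p q r s : V) : Prop :=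
  [v, p, q, r, s].Nodup ∧ [c v p, c v q, c v r, c r s].Nodup

/-- There is no rainbow chair. -/
def RainbowChairFree (c : V → V → K) : Prop :=
  ∀ v p q r s, ¬ RainbowChair c v p q r s

/-- All edges outside some set of at most five vertices have one color. -/
def NearlyMonochromatic (c : V → V → K) : Prop :=
  ∃ (S : Finset V) (d : K), S.card ≤ 5 ∧ ∀ x y, x ∉ S → y ∉ S → x ≠ y → c x y = d

lemma RainbowPathFree.eq {c : V → V → K} (h : RainbowPathFree c) (x₁ x₂ x₃ x₄ x₅ : V)
    (h₁ : (x₁ ≠ x₂ ∧ x₁ ≠ x₃ ∧ x₁ ≠ x₄ ∧ x₁ ≠ x₅) ∧ (x₂ ≠ x₃ ∧ x₂ ≠ x₄ ∧ x₂ ≠ x₅) ∧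
      (x₃ ≠ x₄ ∧ x₃ ≠ x₅) ∧ x₄ ≠ x₅) :
    c x₁ x₂ = c x₂ x₃ ∨ c x₁ x₂ = c x₃ x₄ ∨ c x₁ x₂ = c x₄ x₅ ∨ c x₂ x₃ = c x₃ x₄ ∨
      c x₂ x₃ = c x₄ x₅ ∨ c x₃ x₄ = c x₄ x₅ := by
  have := h x₁ x₂ x₃ x₄ x₅ (by simpa using h₁)
  simp only [List.nodup_cons, List.mem_cons, List.not_mem_nil, or_false, not_or, not_false_eq_true,
    List.nodup_nil, and_true] at this
  tauto

lemma RainbowChair.swap {c : V → V → K} {v p q r s : V} (H : RainbowChair c v p q r s) :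
    RainbowChair c v q p r s := by
  unfold RainbowChair at *
  grind

lemma RainbowChairFree.eq {c : V → V → K} (h : RainbowChairFree c) (v p q r s : V)
    (h₁ : (v ≠ p ∧ v ≠ q ∧ v ≠ r ∧ v ≠ s) ∧ (p ≠ q ∧ p ≠ r ∧ p ≠ s) ∧ (q ≠ r ∧ q ≠ s) ∧ r ≠ s) :
    c v p = c v q ∨ c v p = c v r ∨ c v p = c r s ∨ c v q = c v r ∨
      c v q = c r s ∨ c v r = c r s := by
  have := h v p q r s
  simp only [RainbowChair, List.nodup_cons, List.mem_cons, List.not_mem_nil, or_false, not_or,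
    not_false_eq_true, List.nodup_nil, and_true] at this
  tauto

variable {c : V → V → K} (hc : ∀ x y, c x y = c y x) (h : RainbowPathFree c)
include hc h

/-- A finite check on six vertices: every path listed in the proof must repeat a color, and together
these constraints leave one value for the edge px. -/
lemma RainbowChair.eq_left {v p q r s x : V} (H : RainbowChair c v p q r s)
    (hx : [v, p, q, r, s, x].Nodup) : c p x = c r s := by
  obtain ⟨-, H⟩ := H
  have e := h.eq
  simp only [List.nodup_cons, List.mem_cons, List.not_mem_nil, or_false, not_or, not_false_eq_true,
    List.nodup_nil, and_true] at H hx
  have a1 := e p q v r s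
  have a2 := e q p v r s
  have a3 := e v q p r s
  have a4 := e q v p r s
  have a5 := e q v r s x
  have a6 := e p v r s x
  have a7 := e v p r s x
  have b1 := e v q p x s
  have b2 := e r v p x s
  have b3 := e q v p x s
  have b4 := e p r v q s
  have b5 := e v p q s r
  have b6 := e p v q s r
  have b7 := e q v r p x
  have b8 := e s r v p x
  have b9 := e s q v p x
  have c1 := e r v q p x
  have c2 := e p v r s q
  have c3 := e v q p x r
  have c4 := e v p x r s
  have c5 := e v q s r x
  have c6 := e q v p x r
  clear e h
  grind (splits := 40)

lemma RainbowChair.nearlyMonochromatic {v p q r s : V} (H : RainbowChair c v p q r s) :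
    NearlyMonochromatic c := by
  classical
  refine ⟨{v, p, q, r, s}, c r s, Finset.card_le_five, fun x y hx hy hxy => ?_⟩
  have hp : [v, p, q, r, s, x].Nodup → c p x = c r s := RainbowChair.eq_left hc h H
  have hq : [v, q, p, r, s, x].Nodup → c q x = c r s := RainbowChair.eq_left hc h H.swap
  -- Since px and qx have the color of rs, each of these three paths restricts xy to that color or
  -- two colors from the star at v; no star color survives all three.
  have e₁ := h.eq y x p v q
  have e₂ := h.eq y x p v r
  have e₃ := h.eq y x q v r
  obtain ⟨H₁, H₂⟩ := H
  simp only [List.nodup_cons, List.mem_cons, List.not_mem_nil, or_false, not_or, not_false_eq_true,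
    List.nodup_nil, and_true, Finset.mem_insert,
    Finset.mem_singleton] at *
  clear h
  grind (splits := 40)

variable (hF : RainbowChairFree c)
include hF

/-- Chairs through x force each edge from x to a leaf to copy the color of that leaf's edge to v.
Chairs at v then leave for a₁a₂ only the colors of va₃ and va₄, and the two paths from v through a₁,
a₂, x exclude both. -/
lemma not_rainbow_star_four {v a₁ a₂ a₃ a₄ x : V} (hv : [v, a₁, a₂, a₃, a₄, x].Nodup) :
    ¬ [c v a₁, c v a₂, c v a₃, c v a₄].Nodup := by
  intro H
  have key : ∀ p q r s, [v, p, q, r, s, x].Nodup → [c v p, c v q, c v r, c v s].Nodup →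
      c p x = c v p := by
    intro p q r s hv H
    have f₁ := hF.eq v q r p x
    have f₂ := hF.eq v q s p x
    have f₃ := hF.eq v r s p x
    simp only [List.nodup_cons, List.mem_cons, List.not_mem_nil, or_false, not_or, not_false_eq_true,
    List.nodup_nil, and_true] at hv H
    clear h hF
    grind (splits := 40)
  have k₁ := key a₁ a₂ a₃ a₄
  have k₂ := key a₂ a₁ a₃ a₄
  have k₃ := key a₃ a₁ a₂ a₄
  have k₄ := key a₄ a₁ a₂ a₃
  have f₁ := hF.eq v a₃ a₄ a₂ a₁
  have f₂ := hF.eq v a₃ a₄ a₁ a₂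
  have e₁ := h.eq v a₁ a₂ x a₃
  have e₂ := h.eq v a₁ a₂ x a₄
  clear h hF key
  simp only [List.nodup_cons, List.mem_cons, List.not_mem_nil, or_false, not_or, not_false_eq_true,
    List.nodup_nil, and_true] at *
  grind (splits := 40)

/-- The two paths around the cycle starting at x allow xa only the colors of bd and de; the two
chairs at a exclude these. -/
lemma not_rainbow_cycle_four {a b d e x : V} (hv : [a, b, d, e, x].Nodup) :
    ¬ [c a b, c b d, c d e, c e a].Nodup := by
  intro H
  have e₁ := h.eq x a b d e
  have e₂ := h.eq x a e d b
  have f₁ := hF.eq a b x e d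
  have f₂ := hF.eq a e x b d
  clear h hF
  simp only [List.nodup_cons, List.mem_cons, List.not_mem_nil, or_false, not_or, not_false_eq_true,
    List.nodup_nil, and_true] at *
  grind (splits := 40)

lemma nearlyMonochromatic_of_rainbow_paw {a b d e : V}
    (hS : ∀ S : Finset V, S.card ≤ 6 → ∃ x, x ∉ S)
    (hv : [a, b, d, e].Nodup) (H : [c a b, c b d, c d a, c a e].Nodup) :
    NearlyMonochromatic c := by
  classical
  have side : ∀ b d x, [a, b, d, e, x].Nodup → [c a b, c b d, c d a, c a e].Nodup →
      c x b = c a e := by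
    intro b d x hv H
    have e₁ := h.eq x b d a e
    have f₁ := hF.eq a e d b x
    have f₂ := hF.eq b x d a e
    clear h hF
    simp only [List.nodup_cons, List.mem_cons, List.not_mem_nil, or_false, not_or, not_false_eq_true,
    List.nodup_nil, and_true] at *
    grind (splits := 40)
  have apex : ∀ x, [a, b, d, e, x].Nodup → c x a = c a e := by
    intro x hx
    -- A sixth vertex is needed: the edge by, which has the color of ae, rules out the color of bd
    -- for xa through the chair `f₃`.
    obtain ⟨y, hy⟩ := hS {a, b, d, e, x} (Finset.card_le_five.trans (by norm_num))
    have hy' := side b d y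
    have f₁ := hF.eq a x e b d
    have f₂ := hF.eq a x e d b
    have f₃ := hF.eq a x d b y
    clear h hF side hS
    simp only [List.nodup_cons, List.mem_cons, List.not_mem_nil, or_false, not_or, not_false_eq_true,
    List.nodup_nil, and_true, Finset.mem_insert,
      Finset.mem_singleton] at *
    grind (splits := 40)
  refine ⟨{a, b, d, e}, c a e, Finset.card_le_four.trans (by norm_num), fun x y hx hy hxy => ?_⟩
  have k₁ := apex x
  have k₂ := side b d x
  have k₃ := side d b x
  have e₁ := h.eq y x a b d
  have e₂ := h.eq y x a d b
  have e₃ := h.eq y x b a d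
  clear h hF side apex hS
  simp only [List.nodup_cons, List.mem_cons, List.not_mem_nil, or_false, not_or, not_false_eq_true,
    List.nodup_nil, and_true, Finset.mem_insert,
      Finset.mem_singleton] at *
  grind (splits := 40)

end Structure
-- A dominant color when at least four colors occur.
section Dominant

variable {V K : Type*}

/-- No connected graph with four edges has a rainbow copy. -/
structure ConnectedRainbowFree (c : V → V → K) : Prop where
  symm : ∀ x y, c x y = c y x
  path : ∀ x₁ x₂ x₃ x₄ x₅, [x₁, x₂, x₃, x₄, x₅].Nodup →
    ¬ [c x₁ x₂, c x₂ x₃, c x₃ x₄, c x₄ x₅].Nodup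
  chair : ∀ v p q r s, [v, p, q, r, s].Nodup → ¬ [c v p, c v q, c v r, c r s].Nodup
  star : ∀ v p q r s, [v, p, q, r, s].Nodup → ¬ [c v p, c v q, c v r, c v s].Nodup
  cycle : ∀ p q r s, [p, q, r, s].Nodup → ¬ [c p q, c q r, c r s, c s p].Nodup
  paw : ∀ p q r s, [p, q, r, s].Nodup → ¬ [c p q, c q r, c r p, c p s].Nodup

lemma connectedRainbowFree_or_nearlyMonochromatic {c : V → V → K} (hc : ∀ x y, c x y = c y x)
    (h : RainbowPathFree c) (hS : ∀ S : Finset V, S.card ≤ 6 → ∃ x, x ∉ S) :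
    ConnectedRainbowFree c ∨ NearlyMonochromatic c := by
  classical
  refine or_iff_not_imp_right.2 fun hn => ?_
  have hF : RainbowChairFree c := fun v p q r s H =>
    hn (RainbowChair.nearlyMonochromatic hc h H)
  refine ⟨hc, h, fun v p q r s h₁ h₂ => hF v p q r s ⟨h₁, h₂⟩, fun v p q r s h₁ => ?_,
    fun p q r s h₁ => ?_, fun p q r s h₁ h₂ =>
    hn (nearlyMonochromatic_of_rainbow_paw hc h hF hS h₁ h₂)⟩
  · obtain ⟨x, hx⟩ := hS {v, p, q, r, s} (Finset.card_le_five.trans (by norm_num))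
    refine not_rainbow_star_four hc h hF (x := x) ?_
    simp only [List.nodup_cons, List.mem_cons, List.not_mem_nil, Finset.mem_insert,
      Finset.mem_singleton] at *
    grind
  · obtain ⟨x, hx⟩ := hS {p, q, r, s} (Finset.card_le_four.trans (by norm_num))
    refine not_rainbow_cycle_four hc h hF (x := x) ?_
    simp only [List.nodup_cons, List.mem_cons, List.not_mem_nil, Finset.mem_insert,
      Finset.mem_singleton] at *
    grind

/-- At least four colors are used. -/
def UsesFourColors (c : V → V → K) : Prop :=
  ∀ i j l, ∃ u v, u ≠ v ∧ c u v ≠ i ∧ c u v ≠ j ∧ c u v ≠ l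

variable {c : V → V → K} (T : ConnectedRainbowFree c) (h4 : UsesFourColors c)
include T

include h4 in
-- An edge uv of a fourth color that meets the triangle gives a rainbow paw. If it is disjoint, two
-- paths and a chair force ux to have the color of uv, which again gives a rainbow paw.
lemma ConnectedRainbowFree.triangle (x y z : V) :
    ¬ (x ≠ y ∧ y ≠ z ∧ x ≠ z ∧ c x y ≠ c y z ∧ c x y ≠ c x z ∧ c y z ≠ c x z) := by
  intro H
  obtain ⟨u, v, huv, h₁, h₂, h₃⟩ := h4 (c x y) (c y z) (c x z)
  have hc := T.symm
  have a₁ := T.paw x y z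
  have a₂ := T.paw y z x
  have a₃ := T.paw z x y
  have b₁ := T.path v u x y z
  have b₂ := T.path v u x z y
  have b₃ := T.chair x y z u v
  clear T h4
  simp only [List.nodup_cons, List.mem_cons, List.not_mem_nil, or_false, not_or, not_false_eq_true,
    List.nodup_nil, and_true] at *
  have a₁u := a₁ u
  have a₂u := a₂ u
  have a₃u := a₃ u
  have a₁v := a₁ v
  have a₂v := a₂ v
  have a₃v := a₃ v
  clear a₁ a₂ a₃
  grind +splitImp (splits := 40)

include h4 in
-- An edge uv of a fourth color that meets the claw creates a rainbow star, chair or paw. If it is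
-- disjoint, the chairs `d₁`, `d₂`, `d₃` force xu to have the color of uv, a rainbow star.
lemma ConnectedRainbowFree.claw (x p q r : V) :
    ¬ (x ≠ p ∧ x ≠ q ∧ x ≠ r ∧ c x p ≠ c x q ∧ c x p ≠ c x r ∧ c x q ≠ c x r) := by
  intro H
  obtain ⟨u, v, huv, h₁, h₂, h₃⟩ := h4 (c x p) (c x q) (c x r)
  wlog hu : u ≠ x ∧ (u = p ∨ u = q ∨ u = r ∨ (v ≠ p ∧ v ≠ q ∧ v ≠ r)) generalizing u v
  · refine this v u huv.symm ?_ ?_ ?_ ?_ <;> have hc := T.symm <;> clear T h4 <;> grind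
  have hc := T.symm
  have a₁ := T.star x p q r u
  have a₂ := T.star x p q r v
  have b₁ := T.chair x p q r v
  have b₂ := T.chair x p r q v
  have b₃ := T.chair x q r p v
  have d₁ := T.chair x p q u v
  have d₂ := T.chair x p r u v
  have d₃ := T.chair x q r u v
  have e₁ := T.paw x p q r
  have e₂ := T.paw x p r q
  have e₃ := T.paw x q r p
  clear T h4
  simp only [List.nodup_cons, List.mem_cons, List.not_mem_nil, or_false, not_or, not_false_eq_true,
    List.nodup_nil, and_true] at *
  grind +splitImp (splits := 40)

include h4 in
-- The middle color of the path is the future dominant color. At x and y it is forced by the absence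
-- of rainbow claws and of paths starting with vu; the edges uw and uz then follow from the claws at
-- u and the paths obtained by extending the given one to u.
lemma ConnectedRainbowFree.cross {w x y z u v : V} (hv : [w, x, y, z].Nodup) (huv : u ≠ v)
    (H : [c w x, c x y, c y z, c u v].Nodup) :
    (u ≠ w ∧ u ≠ x ∧ u ≠ y ∧ u ≠ z ∧ v ≠ w ∧ v ≠ x ∧ v ≠ y ∧ v ≠ z) ∧
      (c u w = c x y ∧ c u x = c x y ∧ c u y = c x y ∧ c u z = c x y) := by
  have hc := T.symm
  have t := T.triangle h4
  have s := T.claw h4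
  have hn : ∀ u v, u ≠ v → [c w x, c x y, c y z, c u v].Nodup →
      u ≠ w ∧ u ≠ x ∧ u ≠ y ∧ u ≠ z := by
    intro u v huv H
    have a₁ := T.path v w x y z
    have a₂ := T.path v z y x w
    have a₃ := T.cycle w x y z
    have a₄ := t w x y
    have a₅ := t x y z
    have a₆ := s x w y v
    have a₇ := s y x z v
    clear T h4 t s
    simp only [List.nodup_cons, List.mem_cons, List.not_mem_nil, or_false, not_or,
      not_false_eq_true, List.nodup_nil, and_true] at *
    grind +splitImp (splits := 40)
  have h₁ := hn u v huv H
  have h₂ := hn v u huv.symm (by rwa [hc v u])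
  have b₁ := T.path v u x y z
  have b₂ := T.path v u y x w
  have b₃ := T.path v u w x y
  have b₄ := T.path v u z y x
  have b₅ := s x w y u
  have b₆ := s y x z u
  have b₇ := s u v x w
  have b₈ := s u v y z
  have b₉ := T.path u w x y z
  have b₁₀ := T.path u z y x w
  clear T h4 t s hn
  simp only [List.nodup_cons, List.mem_cons, List.not_mem_nil, or_false, not_or,
      not_false_eq_true, List.nodup_nil, and_true] at *
  grind +splitImp (splits := 40)

include h4 in
-- Take adjacent edges ab, bd of different colors and an edge uv of a third. If uv is disjoint from
-- them, the claws at b allow ub only the colors of ab and bd, and either choice gives a rainbow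
-- path from v through u and b.
lemma ConnectedRainbowFree.exists_rainbow_path [Nonempty V] :
    ∃ w x y z, [w, x, y, z].Nodup ∧ [c w x, c x y, c y z].Nodup := by
  have hc := T.symm
  have t := T.triangle h4
  have s := T.claw h4
  obtain ⟨o⟩ := ‹Nonempty V›
  have hch : ∃ a b d, a ≠ b ∧ b ≠ d ∧ c a b ≠ c b d := by
    by_contra! hn
    obtain ⟨a, b, hab, -⟩ := h4 (c o o) (c o o) (c o o)
    obtain ⟨a', b', hab', h', -⟩ := h4 (c a b) (c a b) (c a b)
    have n₁ := hn a b a'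
    have n₂ := hn b a' b'
    have n₃ := hn a b b'
    clear T h4 hn t s
    grind +splitImp (splits := 40)
  obtain ⟨a, b, d, hab, hbd, hne⟩ := hch
  obtain ⟨u, v, huv, h₁, h₂, -⟩ := h4 (c a b) (c b d) (c b d)
  by_contra! hn
  have n₁ := hn v a b d
  have n₂ := hn u a b d
  have n₃ := hn a b d u
  have n₄ := hn a b d v
  have n₅ := hn v u b d
  have n₆ := hn v u b a
  have s₁ := s b a d u
  have s₂ := s b a d v
  have t₁ := t a b d
  clear T h4 t s hn
  simp only [List.nodup_cons, List.mem_cons, List.not_mem_nil, or_false, not_or,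
      not_false_eq_true, List.nodup_nil, and_true] at *
  grind +splitImp (splits := 40)

include h4 in
lemma ConnectedRainbowFree.exists_three_edges [Nonempty V] :
    ∃ w x y z u v D, w ≠ x ∧ y ≠ z ∧ u ≠ v ∧ [c w x, c y z, c u v, D].Nodup ∧
      (u ≠ w ∧ u ≠ x ∧ u ≠ y ∧ u ≠ z ∧ v ≠ w ∧ v ≠ x ∧ v ≠ y ∧ v ≠ z) ∧
      (y ≠ w ∧ y ≠ x ∧ z ≠ w ∧ z ≠ x) ∧
      (c u w = D ∧ c u x = D ∧ c u y = D ∧ c u z = D) ∧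
      (c v w = D ∧ c v x = D ∧ c v y = D ∧ c v z = D) ∧
      (c y w = D ∧ c y x = D ∧ c z w = D ∧ c z x = D) := by
  obtain ⟨w, x, y, z, hv, H⟩ := T.exists_rainbow_path h4
  obtain ⟨u, v, huv, h₁, h₂, h₃⟩ := h4 (c w x) (c x y) (c y z)
  have hc := T.symm
  have k₁ := T.cross h4 hv huv
  have k₂ := T.cross h4 hv huv.symm
  -- The path w, x, u, v is again rainbow with the same middle color, so the roles of yz and uv can
  -- be exchanged.
  have k₃ := T.cross h4 (w := w) (x := x) (y := u) (z := v) (u := y) (v := z)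
  have k₄ := T.cross h4 (w := w) (x := x) (y := u) (z := v) (u := z) (v := y)
  refine ⟨w, x, y, z, u, v, c x y, ?_⟩
  clear T h4
  simp only [List.nodup_cons, List.mem_cons, List.not_mem_nil, or_false, not_or,
      not_false_eq_true, List.nodup_nil, and_true] at *
  grind +splitImp (splits := 40)

include h4 in
/-- In the absence of connected rainbow graphs with four edges, one color is dominant: any two
adjacent edges in other colors have the same color. -/
lemma ConnectedRainbowFree.exists_dominant [Nonempty V] :
    ∃ D, ∀ b p q, b ≠ p → b ≠ q → c b p ≠ D → c b q ≠ D → c b p = c b q := by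
  obtain ⟨w, x, y, z, u, v, D, h₁, h₂, h₃, h₅, h₆, h₇, h₈, h₉, h₁₀⟩ := T.exists_three_edges h4
  have hc := T.symm
  have t := T.triangle h4
  have s := T.claw h4
  have r : ∀ l i j p, l ≠ i → l ≠ j → l ≠ p → c l i ≠ D → c l j = D → c l p ≠ D →
      c l p = c l i := by
    intro l i j p
    have := s l i j p
    grind
  clear T h4 s
  simp only [List.nodup_cons, List.mem_cons, List.not_mem_nil, or_false, not_or,
      not_false_eq_true, List.nodup_nil, and_true] at h₅
  -- If no edge at b had color D, then wb would copy the color of wx and yb that of yz, making the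
  -- triangle b, w, y rainbow. An edge of color D at b lets the claw condition identify all other
  -- colors there.
  have key : ∀ b, ∃ j, b ≠ j ∧ c b j = D := by
    intro b
    by_contra! hb
    have r₁ := r w x u b
    have r₂ := r y z u b
    have t₁ := t b w y
    have b₁ := hb w
    have b₂ := hb y
    have b₃ := hb u
    clear r t hb
    grind +splitImp
  refine ⟨D, fun b p q hp hq hpD hqD => ?_⟩
  obtain ⟨j, hj, hjD⟩ := key b
  exact (r b p j q hp hj hq hpD hjD hqD).symm

include h4 in
/-- The vertices can be partitioned into parts such that all edges between different parts have
the dominant color `D`, and each part has at most one other color inside. -/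
lemma ConnectedRainbowFree.exists_partition [Nonempty V] :
    ∃ (D : K) (π : V → K), ∀ x y, x ≠ y → c x y = D ∨ (π x = π y ∧ c x y = π x) := by
  classical
  obtain ⟨D, hD⟩ := T.exists_dominant h4
  have hc := T.symm
  -- The part of x is the common color of the edges at x not colored D, with default D if there are
  -- none.
  refine ⟨D, fun x => if h : ∃ y, x ≠ y ∧ c x y ≠ D then c x h.choose else D, fun x y hxy => ?_⟩
  refine or_iff_not_imp_left.2 fun hne => ?_
  have hx : ∃ y, x ≠ y ∧ c x y ≠ D := ⟨y, hxy, hne⟩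
  have hy : ∃ x, y ≠ x ∧ c y x ≠ D := ⟨x, hxy.symm, by rwa [hc]⟩
  have h₁ := hD x _ _ hx.choose_spec.1 hxy hx.choose_spec.2 hne
  have h₂ := hD y _ _ hy.choose_spec.1 hxy.symm hy.choose_spec.2 (by rwa [hc])
  simp only [hx, hy, dif_pos, h₁, h₂, hc y x, and_self]

end Dominant
-- Packing copies of H and moving them away from a set.
section Packing

variable {V W : Type*}

/-- A graph without isolated vertices on `2 * a + 1` vertices with independence number at most `a`
which is tripartite with parts of sizes `a`, `a` and `1`. -/
structure IsBalancedTripartite [Fintype W] (H : SimpleGraph W) (a : ℕ) : Prop where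
  one_le : 1 ≤ a
  card_eq : Fintype.card W = 2 * a + 1
  exists_coloring : ∃ τ : W → Fin 3, (∀ u v, H.Adj u v → τ u ≠ τ v) ∧
    ∀ j, Nat.card {w // τ w = j} = ![a, a, 1] j
  card_le_of_indep : ∀ s : Finset W, (∀ u ∈ s, ∀ v ∈ s, ¬ H.Adj u v) → s.card ≤ a
  exists_adj : ∀ u, ∃ v, H.Adj u v

lemma disjointCopies_isContained_iff {m : ℕ} {H : SimpleGraph W} {G : SimpleGraph V} :
    (disjointCopies m H).IsContained G ↔ ∃ f : Fin m × W → V, Function.Injective f ∧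
      ∀ i u v, H.Adj u v → G.Adj (f (i, u)) (f (i, v)) := by
  constructor
  · rintro ⟨f⟩
    exact ⟨f, f.injective, fun i u v h => f.toHom.map_adj ⟨rfl, h⟩⟩
  · rintro ⟨f, hf, h⟩
    refine ⟨⟨⟨f, ?_⟩, hf⟩⟩
    rintro ⟨i, u⟩ ⟨j, v⟩ ⟨rfl, huv⟩
    exact h _ _ _ huv

/-- Blowing up a coloring: copies of `H` found inside a complete multipartite graph. -/
lemma exists_embedding_of_multipartite {ι R : Type*} [Fintype ι] [Finite W] {H : SimpleGraph W}
    {G : SimpleGraph V} (τ : W → R) (hτ : ∀ u v, H.Adj u v → τ u ≠ τ v) (S : R → Finset V)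
    (hS : ∀ j j', j ≠ j' → ∀ x ∈ S j, ∀ y ∈ S j', G.Adj x y)
    (hcard : ∀ j, Fintype.card ι * Nat.card {w // τ w = j} ≤ (S j).card) :
    ∃ f : ι × W → V, Function.Injective f ∧ (∀ i w, f (i, w) ∈ S (τ w)) ∧
      ∀ i u v, H.Adj u v → G.Adj (f (i, u)) (f (i, v)) := by
  classical
  have := Fintype.ofFinite W
  have he : ∀ j, Nonempty (ι × {w // τ w = j} ↪ S j) := fun j => by
    refine Function.Embedding.nonempty_of_card_le ?_
    simpa using hcard j
  let e : ∀ j, ι × {w // τ w = j} ↪ S j := fun j => (he j).some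
  have hmem : ∀ i w, (e (τ w) (i, ⟨w, rfl⟩) : V) ∈ S (τ w) := fun i w => Subtype.coe_prop _
  refine ⟨fun x => e (τ x.2) (x.1, ⟨x.2, rfl⟩), ?_, hmem, fun i u v huv =>
    hS _ _ (hτ u v huv) _ (hmem i u) _ (hmem i v)⟩
  rintro ⟨i, u⟩ ⟨i', u'⟩ h
  have ht : τ u = τ u' := by
    by_contra hne
    have := hS _ _ hne _ (hmem i u) _ (hmem i' u')
    exact this.ne h
  have key : ∀ j j' (hu : τ u = j) (hu' : τ u' = j'), j = j' →
      (e j (i, ⟨u, hu⟩) : V) = e j' (i', ⟨u', hu'⟩) → (i, u) = (i', u') := by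
    rintro j _ hu hu' rfl h
    have := (e j).injective (Subtype.ext h)
    grind
  exact key _ _ rfl rfl ht h

lemma mul_le_card_of_copies {m q : ℕ} [Fintype W] {f : Fin m × W → V}
    (hf : Function.Injective f) (X : Finset V) [DecidablePred (· ∈ X)]
    (hq : ∀ i, q ≤ (Finset.univ.filter fun w => f (i, w) ∈ X).card) : m * q ≤ X.card := by
  classical
  calc m * q = ∑ _i : Fin m, q := by simp
    _ ≤ ∑ i : Fin m, (Finset.univ.filter fun w => f (i, w) ∈ X).card :=
      Finset.sum_le_sum fun i _ => hq i
    _ = (Finset.univ.sigma fun i => Finset.univ.filter fun w => f (i, w) ∈ X).card :=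
      (Finset.card_sigma _ _).symm
    _ ≤ X.card := by
      refine Finset.card_le_card_of_injOn (fun y => f (y.1, y.2)) (fun y hy => by simpa using hy) ?_
      rintro ⟨i, u⟩ - ⟨i', u'⟩ - h
      have := hf h
      grind

/-- Copies failing `p` occupy at most q vertices of X each, so X keeps room for q vertices per copy
satisfying `p`. -/
lemma mul_le_card_sdiff_of_copies {m q : ℕ} [Fintype W] [DecidableEq V] {f : Fin m × W → V}
    (X : Finset V) (p : Fin m → Prop) [DecidablePred p] [DecidablePred (· ∈ X)]
    (hq : ∀ i, (Finset.univ.filter fun w => f (i, w) ∈ X).card ≤ q) (hX : m * q ≤ X.card) :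
    Fintype.card {i // p i} * q ≤
      (X.filter fun x => ∀ i w, ¬ p i → f (i, w) ≠ x).card := by
  classical
  have h₁ : (X.filter fun x => ¬ ∀ i w, ¬ p i → f (i, w) ≠ x).card ≤
      Fintype.card {i // ¬ p i} * q := by
    calc _ ≤ ((Finset.univ.filter fun i => ¬ p i).sigma fun i =>
          Finset.univ.filter fun w => f (i, w) ∈ X).card := by
          refine Finset.card_le_card_of_surjOn (fun y => f (y.1, y.2)) ?_
          intro x hx
          simp only [Finset.coe_filter, Set.mem_ofPred_eq] at hx
          obtain ⟨hxX, hx⟩ := hx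
          push Not at hx
          obtain ⟨i, w, hi, rfl⟩ := hx
          exact ⟨⟨i, w⟩, by simp [hi, hxX], rfl⟩
      _ = ∑ i ∈ Finset.univ.filter fun i => ¬ p i,
          (Finset.univ.filter fun w => f (i, w) ∈ X).card := Finset.card_sigma _ _
      _ ≤ ∑ i ∈ Finset.univ.filter fun i => ¬ p i, q := Finset.sum_le_sum fun i _ => hq i
      _ = _ := by rw [Finset.sum_const, smul_eq_mul, Fintype.card_subtype]
  have h₂ := Finset.card_filter_add_card_filter_not (s := X)
    (fun x => ∀ i w, ¬ p i → f (i, w) ≠ x)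
  have h₃ : Fintype.card {i // p i} + Fintype.card {i // ¬ p i} = m := by
    have := Fintype.card_subtype_compl p
    have := Fintype.card_subtype_le p
    simp at *
    omega
  have h₄ : Fintype.card {i // p i} * q + Fintype.card {i // ¬ p i} * q = m * q := by
    rw [← add_mul, h₃]
  omega

/-- Disjoint copies of `H` may avoid the edges inside `R` if there is enough room in `A` and `B`. -/
lemma disjointCopies_isContained_of_replace {m a : ℕ} [Fintype W] {H : SimpleGraph W}
    (hH : IsBalancedTripartite H a) {G G₀ : SimpleGraph V} {A B R : Finset V}
    (hAB : ∀ x ∈ A, ∀ y ∈ B, G.Adj x y) (hAR : ∀ x ∈ A, ∀ y ∈ R, G.Adj x y)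
    (hBR : ∀ x ∈ B, ∀ y ∈ R, G.Adj x y)
    (hG : ∀ x y, G₀.Adj x y → G.Adj x y ∨ (x ∈ R ∧ y ∈ R))
    (hA : m * (2 * a + 1) ≤ A.card)
    (hB : m * (2 * a + 1) ≤ B.card ∨ (m * a ≤ B.card ∧ ∀ x ∈ B, ∀ y ∈ B, ¬ G₀.Adj x y))
    (h : (disjointCopies m H).IsContained G₀) : (disjointCopies m H).IsContained G := by
  classical
  rw [disjointCopies_isContained_iff] at *
  obtain ⟨f, hf, hadj⟩ := h
  -- Only the copies meeting R are rebuilt: a vertices in A, a vertices in B, and one vertex of R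
  -- that the copy already owns. The untouched copies leave enough of A and B free; when B is
  -- independent in `G₀`, each uses at most a vertices of B.
  let p : Fin m → Prop := fun i => ∃ w, f (i, w) ∈ R
  have hall : ∀ (X : Finset V) i, (Finset.univ.filter fun w => f (i, w) ∈ X).card ≤ 2 * a + 1 :=
    fun X i => (Finset.card_le_univ _).trans hH.card_eq.le
  have hA' := mul_le_card_sdiff_of_copies A p (hall A) hA
  have hB' : Fintype.card {i // p i} * a ≤
      (B.filter fun x => ∀ i w, ¬ p i → f (i, w) ≠ x).card := by
    rcases hB with hB | ⟨hB, hind⟩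
    · exact (Nat.mul_le_mul_left _ (by omega)).trans
        (mul_le_card_sdiff_of_copies B p (hall B) hB)
    · refine mul_le_card_sdiff_of_copies B p (fun i => hH.card_le_of_indep _ ?_) hB
      intro u hu v hv huv
      simp only [Finset.mem_filter, Finset.mem_univ, true_and] at hu hv
      exact hind _ hu _ hv (hadj i u v huv)
  choose r hr using fun i : {i // p i} => i.2
  have hrinj : Function.Injective fun i : {i // p i} => f (i, r i) := by
    intro i j hij
    have := hf hij
    grind
  obtain ⟨τ, hτ, hτc⟩ := hH.exists_coloring
  obtain ⟨g, hg, hgS, hgadj⟩ := exists_embedding_of_multipartite (ι := {i // p i}) (G := G) τ hτ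
    ![A.filter fun x => ∀ i w, ¬ p i → f (i, w) ≠ x, B.filter fun x => ∀ i w, ¬ p i → f (i, w) ≠ x,
      Finset.univ.image fun i : {i // p i} => f (i, r i)]
    (by
      have hR : ∀ x, x ∈ (Finset.univ.image fun i : {i // p i} => f (i, r i)) → x ∈ R := by
        intro x hx
        simp only [Finset.mem_image, Finset.mem_univ, true_and] at hx
        obtain ⟨i, rfl⟩ := hx
        exact hr i
      intro j j' hj x hx y hy
      fin_cases j <;> fin_cases j' <;> simp only [Fin.zero_eta, Fin.mk_one, Fin.reduceFinMk,
        Matrix.cons_val, ne_eq, not_true_eq_false] at hj hx hy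
      · exact hAB x (Finset.mem_filter.1 hx).1 y (Finset.mem_filter.1 hy).1
      · exact hAR x (Finset.mem_filter.1 hx).1 y (hR y hy)
      · exact (hAB y (Finset.mem_filter.1 hy).1 x (Finset.mem_filter.1 hx).1).symm
      · exact hBR x (Finset.mem_filter.1 hx).1 y (hR y hy)
      · exact (hAR y (Finset.mem_filter.1 hy).1 x (hR x hx)).symm
      · exact (hBR y (Finset.mem_filter.1 hy).1 x (hR x hx)).symm)
    (by
      intro j
      rw [hτc]
      fin_cases j
      · exact (Nat.mul_le_mul_left _ (by simp; omega)).trans hA'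
      · exact hB'
      · simp [Finset.card_image_of_injective _ hrinj])
  have hgne : ∀ i u j v, ¬ p j → f (j, v) ≠ g (i, u) := by
    intro i u j v hj
    have := hgS i u
    generalize τ u = t at this
    fin_cases t <;> simp only [Fin.zero_eta, Fin.mk_one, Fin.reduceFinMk,
        Matrix.cons_val] at this
    · exact (Finset.mem_filter.1 this).2 j v hj
    · exact (Finset.mem_filter.1 this).2 j v hj
    · simp only [Finset.mem_image, Finset.mem_univ, true_and] at this
      obtain ⟨l, hl⟩ := this
      intro h
      have := hf (hl.trans h.symm)
      have hlp := l.2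
      grind
  refine ⟨fun x => if hx : p x.1 then g (⟨x.1, hx⟩, x.2) else f x, ?_, ?_⟩
  · rintro ⟨i, u⟩ ⟨j, v⟩ hij
    by_cases hi : p i <;> by_cases hj : p j <;> simp only [hi, hj, dite_true, dite_false] at hij
    · have := hg hij
      grind
    · exact (hgne _ _ _ _ hj hij.symm).elim
    · exact (hgne _ _ _ _ hi hij).elim
    · exact hf hij
  · intro i u v huv
    by_cases hi : p i <;> simp only [hi, dite_true, dite_false]
    · exact hgadj _ _ _ huv
    · exact (hG _ _ (hadj i u v huv)).resolve_right fun h => hi ⟨u, h.1⟩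

end Packing
-- Three-color Ramsey numbers: a lower bound and existence.
section Colorings

variable {V W K : Type*}

/-- The graph formed by the edges of color `d`. -/
def colorGraph (c : V → V → K) (hc : ∀ x y, c x y = c y x) (d : K) : SimpleGraph V where
  Adj x y := x ≠ y ∧ c x y = d
  symm := ⟨fun x y h => ⟨h.1.symm, by rw [hc]; exact h.2⟩⟩
  loopless := ⟨fun _ h => h.1 rfl⟩

/-- Every coloring of the edges of the complete graph on `V` with three colors contains a
monochromatic copy of `H`. -/
def IsThreeRamsey (V : Type*) (H : SimpleGraph W) : Prop :=
  ∀ (c : V → V → Fin 3) (hc : ∀ x y, c x y = c y x), ∃ d, H.IsContained (colorGraph c hc d)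

lemma isThreeRamsey_of_mem_ramseySet {n : ℕ} {H : SimpleGraph W} (h : n ∈ ramseySet 3 H) :
    IsThreeRamsey (Fin n) H := by
  intro c hc
  obtain ⟨d, hd⟩ := h (EdgeLabeling.mk (fun x y _ => c x y) fun x y _ => hc y x)
  refine ⟨d, hd.mono_right fun x y hxy => ?_⟩
  rw [TopEdgeLabeling.labelGraph_adj] at hxy
  obtain ⟨hne, h⟩ := hxy
  exact ⟨hne, h⟩

/-- Three-color lower bound: nested cliques whose sizes are too small for `m` copies of `H`. -/
lemma le_card_of_isThreeRamsey {n m a : ℕ} [Fintype W] {H : SimpleGraph W}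
    (hH : IsBalancedTripartite H a) (hm : 1 ≤ m)
    (h : IsThreeRamsey (Fin n) (disjointCopies m H)) : m * (4 * a + 3) ≤ n + 2 := by
  classical
  by_contra! hlt
  -- Level 0 has at most m(2a+1) - 1 vertices, levels 1 and 2 at most m(a+1) - 1 each; an edge gets
  -- the larger level of its ends.
  let l : Fin n → Fin 3 := fun x =>
    if (x : ℕ) + 1 < m * (2 * a + 1) then 0
    else if (x : ℕ) + 2 < m * (2 * a + 1) + m * (a + 1) then 1 else 2
  obtain ⟨d, hd⟩ := h (fun x y => max (l x) (l y)) fun x y => max_comm _ _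
  obtain ⟨f, hf, hadj⟩ := disjointCopies_isContained_iff.1 hd
  have hle : ∀ i u, l (f (i, u)) ≤ d := fun i u => by
    obtain ⟨v, hv⟩ := hH.exists_adj u
    have := (hadj i u v hv).2
    exact this ▸ le_max_left _ _
  have hX := fun q => mul_le_card_of_copies (q := q) hf (Finset.univ.filter fun x => l x = d)
  -- Vertices of a copy below level d span no edge of color d, so at most a of its 2a + 1 vertices
  -- lie there.
  have hbig : ∀ i, a + 1 ≤ (Finset.univ.filter fun w => f (i, w) ∈
      Finset.univ.filter fun x => l x = d).card := by
    intro i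
    have h₁ := Finset.card_filter_add_card_filter_not (s := (Finset.univ : Finset W))
      (fun w => f (i, w) ∈ Finset.univ.filter fun x => l x = d)
    have h₂ := hH.card_le_of_indep
      (Finset.univ.filter fun w => ¬ f (i, w) ∈ Finset.univ.filter fun x => l x = d) (by
        intro u hu v hv huv
        have := (hadj i u v huv).2
        simp only [Finset.mem_filter, Finset.mem_univ, true_and] at hu hv
        rcases max_choice (l (f (i, u))) (l (f (i, v))) with h | h <;> simp_all)
    rw [Finset.card_univ, hH.card_eq] at h₁
    omega
  have hcard : ∀ (X : Finset (Fin n)) (s t : ℕ), (∀ x ∈ X, s ≤ (x : ℕ) ∧ (x : ℕ) < t) →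
      X.card ≤ t - s := by
    intro X s t hX
    have := Finset.card_le_card_of_injOn (s := X) (t := Finset.Ico s t) (fun x => (x : ℕ))
      (fun x hx => by simpa using hX x hx) (fun x _ y _ hxy => Fin.ext hxy)
    simpa using this
  have hma : m * (4 * a + 3) = m * (2 * a + 1) + m * (a + 1) + m * (a + 1) := by ring
  have hpos : 1 ≤ m * (a + 1) := Nat.mul_pos hm (by omega)
  have hpos' : m * (a + 1) ≤ m * (2 * a + 1) := Nat.mul_le_mul_left _ (by omega)
  fin_cases d
  · have h₁ := hX (2 * a + 1) (fun i => by
      rw [Finset.filter_true_of_mem, Finset.card_univ, hH.card_eq]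
      intro w _
      simpa using hle i w)
    have h₂ := hcard (Finset.univ.filter fun x => l x = 0) 0 (m * (2 * a + 1) - 1) (by
      intro x hx
      simp only [Finset.mem_filter, Finset.mem_univ, true_and, l] at hx
      split_ifs at hx
      all_goals simp_all
      all_goals omega)
    have h₃ := h₁.trans h₂
    omega
  · have h₁ := hX (a + 1) hbig
    have h₂ := hcard (Finset.univ.filter fun x => l x = 1) (m * (2 * a + 1) - 1)
      (m * (2 * a + 1) + m * (a + 1) - 2) (by
      intro x hx
      simp only [Finset.mem_filter, Finset.mem_univ, true_and, l] at hx
      split_ifs at hx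
      all_goals simp_all
      all_goals omega)
    have h₃ := h₁.trans h₂
    omega
  · have h₁ := hX (a + 1) hbig
    have h₂ := hcard (Finset.univ.filter fun x => l x = 2) (m * (2 * a + 1) + m * (a + 1) - 2)
      n (by
      intro x hx
      simp only [Finset.mem_filter, Finset.mem_univ, true_and, l] at hx
      split_ifs at hx
      all_goals simp_all)
    have h₃ := h₁.trans h₂
    omega

/-- Ramsey's theorem for three colors, with prescribed clique sizes. -/
lemma exists_ramsey_bound (N : ℕ) : ∀ t : Fin 3 → ℕ, ∑ i, t i = N → ∃ n : ℕ, ∀ (V : Type)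
    (c : V → V → Fin 3), (∀ x y, c x y = c y x) → ∀ S : Finset V, n ≤ S.card →
    ∃ i, ∃ T ⊆ S, T.card = t i ∧ ∀ x ∈ T, ∀ y ∈ T, x ≠ y → c x y = i := by
  classical
  induction N with
  | zero =>
    intro t ht
    have : t 0 = 0 := by
      rw [Finset.sum_eq_zero_iff] at ht
      exact ht 0 (Finset.mem_univ _)
    exact ⟨0, fun V c _ S _ => ⟨0, ∅, by simp, by simp [this], by simp⟩⟩
  | succ N ih =>
    intro t ht
    by_cases h0 : ∃ i, t i = 0
    · obtain ⟨i, hi⟩ := h0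
      exact ⟨0, fun V c _ S _ => ⟨i, ∅, by simp, by simp [hi], by simp⟩⟩
    push Not at h0
    have hs : ∀ i, ∑ j, Function.update t i (t i - 1) j = N := by
      intro i
      have h₁ := Finset.sum_update_of_mem (Finset.mem_univ i) t (t i - 1)
      have h₂ := Finset.add_sum_erase Finset.univ t (Finset.mem_univ i)
      rw [Finset.sdiff_singleton_eq_erase] at h₁
      have := h0 i
      omega
    choose n hn using fun i => ih _ (hs i)
    -- After removal of a vertex x, some color i has at least `n i` edges from x, and x extends a
    -- clique of color i found among those neighbors.
    refine ⟨1 + ∑ i, n i, fun V c hc S hS => ?_⟩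
    obtain ⟨x, hx⟩ : S.Nonempty := Finset.card_pos.1 (by omega)
    have hcard : ∑ i, n i ≤ ∑ i, ((S.erase x).filter fun y => c x y = i).card := by
      rw [← Finset.card_eq_sum_card_fiberwise (fun y _ => Finset.mem_coe.2 (Finset.mem_univ _)),
        Finset.card_erase_of_mem hx]
      omega
    obtain ⟨i, -, hi⟩ := Finset.exists_le_of_sum_le (Finset.univ_nonempty) hcard
    obtain ⟨j, T, hT, hTc, hTm⟩ := hn i V c hc _ hi
    have hTS : T ⊆ S := hT.trans ((Finset.filter_subset _ _).trans (Finset.erase_subset _ _))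
    by_cases hij : j = i
    · subst hij
      have hxT : x ∉ T := fun h => by simpa using hT h
      refine ⟨j, insert x T, Finset.insert_subset hx hTS, ?_, ?_⟩
      · rw [Finset.card_insert_of_notMem hxT, hTc, Function.update_self]
        have := h0 j
        omega
      · have hxc : ∀ y ∈ T, c x y = j := fun y hy => (Finset.mem_filter.1 (hT hy)).2
        intro y hy z hz hyz
        rcases Finset.mem_insert.1 hy with rfl | hy' <;>
          rcases Finset.mem_insert.1 hz with rfl | hz'
        · exact (hyz rfl).elim
        · exact hxc z hz'
        · rw [hc]; exact hxc y hy'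
        · exact hTm y hy' z hz' hyz
    · exact ⟨j, T, hTS, by rw [hTc, Function.update_of_ne hij], hTm⟩

lemma isContained_of_clique {G : SimpleGraph V} [Fintype W] (H : SimpleGraph W) (T : Finset V)
    (hT : Fintype.card W ≤ T.card) (h : ∀ x ∈ T, ∀ y ∈ T, x ≠ y → G.Adj x y) :
    H.IsContained G := by
  obtain ⟨e⟩ := Function.Embedding.nonempty_of_card_le (α := W) (β := T) (by simpa using hT)
  refine ⟨⟨⟨fun w => e w, fun {u v} huv => h _ (e u).2 _ (e v).2 ?_⟩, ?_⟩⟩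
  · intro h
    exact huv.ne (e.injective (Subtype.ext h))
  · exact Subtype.coe_injective.comp e.injective

lemma ramseySet_three_nonempty [Fintype W] (H : SimpleGraph W) : (ramseySet 3 H).Nonempty := by
  obtain ⟨n, hn⟩ := exists_ramsey_bound _ (fun _ => Fintype.card W) rfl
  refine ⟨n, fun C => ?_⟩
  obtain ⟨i, T, -, hT, h⟩ := hn (Fin n) (fun x y => if h : x ≠ y then C.get x y h else 0)
    (fun x y => by
      by_cases hxy : x = y
      · simp [hxy]
      · simp only [ne_eq, hxy, Ne.symm hxy, not_false_eq_true, dite_true]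
        exact EdgeLabeling.get_comm y x _) Finset.univ (by simp)
  refine ⟨i, isContained_of_clique H T hT.ge fun x hx y hy hxy => ?_⟩
  rw [TopEdgeLabeling.labelGraph_adj]
  have := h x hx y hy hxy
  rw [dif_pos hxy] at this
  exact ⟨hxy, this⟩

end Colorings
-- Finding mH in a coloring with a dominant color.
section DominantColor

variable {V W K : Type*}

/-- Greedy: terms below L are added one at a time, so the first sum to reach L is still below 2L. -/
lemma exists_subset_sum_lt_two_mul [DecidableEq K] {L : ℕ} (hL : 0 < L) (s : K → ℕ) (T : Finset K)
    (hs : ∀ j ∈ T, s j < L) (hT : L ≤ ∑ j ∈ T, s j) :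
    ∃ T' ⊆ T, L ≤ ∑ j ∈ T', s j ∧ ∑ j ∈ T', s j < 2 * L := by
  induction T using Finset.induction_on with
  | empty => simp at hT; omega
  | insert j T hj ih =>
    by_cases h : L ≤ ∑ j ∈ T, s j
    · obtain ⟨T', hT', h⟩ := ih (fun i hi => hs i (Finset.mem_insert_of_mem hi)) h
      exact ⟨T', hT'.trans (Finset.subset_insert _ _), h⟩
    · refine ⟨_, subset_rfl, hT, ?_⟩
      rw [Finset.sum_insert hj]
      have := hs j (Finset.mem_insert_self _ _)
      omega

variable [Fintype V] [Fintype W] [DecidableEq K] {c : V → V → K} {hc : ∀ x y, c x y = c y x}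
  {D : K} {π : V → K} {H : SimpleGraph W} {m a : ℕ}

/-- Disjoint groups of parts are joined completely in color D, which leaves room for the
tripartition of all m copies. -/
lemma isContained_of_three_groups (hπ : ∀ x y, x ≠ y → c x y = D ∨ (π x = π y ∧ c x y = π x))
    (hH : IsBalancedTripartite H a) (T : Fin 3 → Finset K)
    (hT : ∀ i j, i ≠ j → Disjoint (T i) (T j))
    (hm : ∀ j, m * ![a, a, 1] j ≤ ∑ l ∈ T j, (Finset.univ.filter fun x => π x = l).card) :
    (disjointCopies m H).IsContained (colorGraph c hc D) := by
  obtain ⟨τ, hτ, hτc⟩ := hH.exists_coloring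
  obtain ⟨f, hf, -, h⟩ := exists_embedding_of_multipartite (ι := Fin m) (G := colorGraph c hc D)
    τ hτ (fun j => Finset.univ.filter fun x => π x ∈ T j)
    (by
      intro i j hij x hx y hy
      simp only [Finset.mem_filter, Finset.mem_univ, true_and] at hx hy
      have hne : π x ≠ π y := fun h => Finset.disjoint_left.1 (hT i j hij) hx (h ▸ hy)
      have hxy : x ≠ y := fun h => hne (h ▸ rfl)
      exact ⟨hxy, (hπ x y hxy).resolve_right fun h => hne h.1⟩)
    (by
      intro j
      rw [hτc, Fintype.card_fin]
      refine (hm j).trans (le_of_eq ?_)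
      rw [Finset.card_eq_sum_card_fiberwise (f := π) (t := T j) (fun x hx => by simpa using hx)]
      refine Finset.sum_congr rfl fun l hl => ?_
      congr 1
      ext x
      simp only [Finset.mem_filter, Finset.mem_univ, true_and]
      exact ⟨fun h => ⟨h ▸ hl, h⟩, fun h => h.2⟩)
  exact disjointCopies_isContained_iff.2 ⟨f, hf, h⟩

omit [Fintype V] in
-- As H has no isolated vertices, every vertex of every copy lies in X.
lemma not_isContained_of_card_lt (hH : IsBalancedTripartite H a) {G : SimpleGraph V}
    {X : Finset V} (hX : ∀ x y, G.Adj x y → x ∈ X) (hcard : X.card < m * (2 * a + 1)) :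
    ¬ (disjointCopies m H).IsContained G := by
  classical
  intro h
  obtain ⟨f, hf, hadj⟩ := disjointCopies_isContained_iff.1 h
  refine hcard.not_ge (mul_le_card_of_copies hf X fun i => ?_)
  rw [Finset.filter_true_of_mem, Finset.card_univ, hH.card_eq]
  intro w _
  obtain ⟨v, hv⟩ := hH.exists_adj w
  exact hX _ _ (hadj i w v hv)

variable (hπ : ∀ x y, x ≠ y → c x y = D ∨ (π x = π y ∧ c x y = π x))
  (hH : IsBalancedTripartite H a) (hR : IsThreeRamsey V (disjointCopies m H))
include hπ hH hR

/-- One part is so large that the complement cannot contain `m` copies of `H`. -/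
lemma exists_isContained_of_one_large_part (i : K)
    (hi : (Finset.univ.filter fun x => π x ≠ i).card < m * (2 * a + 1)) :
    ∃ d, (disjointCopies m H).IsContained (colorGraph c hc d) := by
  classical
  -- Color 0 lies within D, color 1 within color i, and color 2 lives on too few vertices to contain
  -- mH.
  obtain ⟨d, hd⟩ := hR (fun x y => if π x = i ∧ π y = i then (if c x y = D then 0 else 1)
    else if π x ≠ i ∧ π y ≠ i then 2 else 0) (fun x y => by
      simp only [hc y x, and_comm])
  fin_cases d
  · refine ⟨D, hd.mono_right fun x y hxy => ⟨hxy.1, ?_⟩⟩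
    have h₁ := hxy.2
    have h₂ := hπ x y hxy.1
    simp only [Fin.zero_eta] at h₁
    split_ifs at h₁ <;> grind
  · refine ⟨i, hd.mono_right fun x y hxy => ⟨hxy.1, ?_⟩⟩
    have h₁ := hxy.2
    have h₂ := hπ x y hxy.1
    simp only [Fin.mk_one] at h₁
    split_ifs at h₁ <;> grind
  · refine (not_isContained_of_card_lt hH (fun x y hxy => ?_) hi hd).elim
    have h₁ := hxy.2
    simp only [Fin.reduceFinMk] at h₁
    simp only [Finset.mem_filter, Finset.mem_univ, true_and]
    split_ifs at h₁ <;> grind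

/-- Two parts cover all but a few vertices. -/
lemma exists_isContained_of_two_large_parts {i j : K} (hij : i ≠ j)
    (hi : m * (2 * a + 1) ≤ (Finset.univ.filter fun x => π x = i).card)
    (hj : m * a ≤ (Finset.univ.filter fun x => π x = j).card) :
    ∃ d, (disjointCopies m H).IsContained (colorGraph c hc d) := by
  classical
  -- Color 0 lies within D except for edges avoiding parts i and j, and those are handled by
  -- replacement. If part j is too small for mH, it is given color 2 entirely, which makes it
  -- independent in color 0; otherwise it keeps its edges of color D as color 0.
  obtain ⟨d, hd⟩ := hR (fun x y => if π x = i ∧ π y = i then (if c x y = D then 0 else 1)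
    else if π x = j ∧ π y = j then
      (if (Finset.univ.filter fun x => π x = j).card < m * (2 * a + 1) then 2
        else if c x y = D then 0 else 2)
    else 0) (fun x y => by
      simp only [hc y x, and_comm])
  fin_cases d
  · refine ⟨D, disjointCopies_isContained_of_replace hH
      (A := Finset.univ.filter fun x => π x = i) (B := Finset.univ.filter fun x => π x = j)
      (R := Finset.univ.filter fun x => π x ≠ i ∧ π x ≠ j) ?_ ?_ ?_ ?_ hi ?_ hd⟩
    · intro x hx y hy
      have hxy : x ≠ y := by grind
      have := hπ x y hxy
      exact ⟨hxy, by grind⟩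
    · intro x hx y hy
      have hxy : x ≠ y := by grind
      have := hπ x y hxy
      exact ⟨hxy, by grind⟩
    · intro x hx y hy
      have hxy : x ≠ y := by grind
      have := hπ x y hxy
      exact ⟨hxy, by grind⟩
    · intro x y hxy
      have h₁ := hxy.2
      have h₂ := hπ x y hxy.1
      refine or_iff_not_imp_left.2 fun hne => ?_
      have h₃ : c x y ≠ D := fun h => hne ⟨hxy.1, h⟩
      simp only [Fin.zero_eta, h₃] at h₁
      simp only [Finset.mem_filter, Finset.mem_univ, true_and]
      split_ifs at h₁ <;> grind
    · refine or_iff_not_imp_left.2 fun hlt => ⟨hj, fun x hx y hy hxy => ?_⟩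
      have h₁ := hxy.2
      simp only [Finset.mem_filter, Finset.mem_univ, true_and] at hx hy
      simp only [hx, hy, hij.symm, not_le.1 hlt, Fin.zero_eta, and_self, if_true, if_false] at h₁
      exact absurd h₁ (by decide)
  · refine ⟨i, hd.mono_right fun x y hxy => ⟨hxy.1, ?_⟩⟩
    have h₁ := hxy.2
    have h₂ := hπ x y hxy.1
    simp only [Fin.mk_one] at h₁
    split_ifs at h₁ <;> grind
  · by_cases hlt : (Finset.univ.filter fun x => π x = j).card < m * (2 * a + 1)
    · refine (not_isContained_of_card_lt hH (fun x y hxy => ?_) hlt hd).elim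
      have h₁ := hxy.2
      simp only [Fin.reduceFinMk] at h₁
      simp only [Finset.mem_filter, Finset.mem_univ, true_and]
      split_ifs at h₁ <;> grind
    · refine ⟨j, hd.mono_right fun x y hxy => ⟨hxy.1, ?_⟩⟩
      have h₁ := hxy.2
      have h₂ := hπ x y hxy.1
      simp only [Fin.reduceFinMk] at h₁
      split_ifs at h₁ <;> grind

/-- A coloring with a dominant color contains a monochromatic copy of `mH`. -/
lemma exists_isContained_of_dominant [Fintype K] (hm : 1 ≤ m)
    (hcard : m * (4 * a + 3) ≤ Fintype.card V + 2) :
    ∃ d, (disjointCopies m H).IsContained (colorGraph c hc d) := by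
  set s : K → ℕ := fun l => (Finset.univ.filter fun x => π x = l).card with hs
  have hsum : ∑ l, s l = Fintype.card V :=
    (Finset.card_eq_sum_card_fiberwise (fun x _ => Finset.mem_coe.2 (Finset.mem_univ (π x)))).symm
  have hcompl : ∀ i, (Finset.univ.filter fun x => π x ≠ i).card + s i = Fintype.card V := by
    intro i
    rw [add_comm]
    exact Finset.card_filter_add_card_filter_not _
  have hone := hH.one_le
  have hL : 0 < m * a := Nat.mul_pos hm hone
  have hma : m ≤ m * a := Nat.le_mul_of_pos_right m hone
  have e₁ : m * (4 * a + 3) = 4 * (m * a) + 3 * m := by ring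
  have e₂ : m * (2 * a + 1) = 2 * (m * a) + m := by ring
  have groups : ∀ T₁ T₂ T₃ : Finset K, Disjoint T₁ T₂ → Disjoint T₁ T₃ → Disjoint T₂ T₃ →
      m * a ≤ ∑ l ∈ T₁, s l → m * a ≤ ∑ l ∈ T₂, s l → m ≤ ∑ l ∈ T₃, s l →
      ∃ d, (disjointCopies m H).IsContained (colorGraph c hc d) := by
    intro T₁ T₂ T₃ h₁₂ h₁₃ h₂₃ h₁ h₂ h₃
    refine ⟨D, isContained_of_three_groups hπ hH ![T₁, T₂, T₃] ?_ ?_⟩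
    · intro i j hij
      fin_cases i <;> fin_cases j <;> first | exact absurd rfl hij | skip
      exacts [h₁₂, h₁₃, h₁₂.symm, h₂₃, h₁₃.symm, h₂₃.symm]
    · intro j
      fin_cases j
      · exact h₁
      · exact h₂
      · simpa using h₃
  have hsub : ∀ T T' : Finset K, T' ⊆ T →
      ∑ l ∈ T \ T', s l + ∑ l ∈ T', s l = ∑ l ∈ T, s l := fun T T' h => Finset.sum_sdiff h
  by_cases hone : ∃ i, m * a ≤ s i
  · obtain ⟨i, hi⟩ := hone
    by_cases hsmall : (Finset.univ.filter fun x => π x ≠ i).card < m * (2 * a + 1)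
    · exact exists_isContained_of_one_large_part hπ hH hR i hsmall
    have hrest := hsub Finset.univ {i} (Finset.subset_univ _)
    rw [Finset.sum_singleton] at hrest
    have hci := hcompl i
    by_cases htwo : ∃ j, i ≠ j ∧ m * a ≤ s j
    · obtain ⟨j, hij, hj⟩ := htwo
      have hp := hsub Finset.univ {i, j} (Finset.subset_univ _)
      rw [Finset.sum_pair hij] at hp
      by_cases hr : m ≤ ∑ l ∈ Finset.univ \ {i, j}, s l
      · exact groups {i} {j} (Finset.univ \ {i, j}) (by simpa using hij) (by simp) (by simp)
          (by simpa using hi) (by simpa using hj) hr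
      -- The lower bound on the order is sharp here: with at most m - 1 vertices elsewhere, the two
      -- parts have at least 2m(2a+1) - 1 vertices, so one of them has m(2a+1).
      · by_cases hle : m * (2 * a + 1) ≤ s i
        · exact exists_isContained_of_two_large_parts hπ hH hR hij hle hj
        · exact exists_isContained_of_two_large_parts hπ hH hR hij.symm
            (show m * (2 * a + 1) ≤ s j by omega) hi
    · push Not at htwo
      obtain ⟨T, hT, hT₁, hT₂⟩ := exists_subset_sum_lt_two_mul hL s (Finset.univ \ {i})
        (fun j hj => htwo j (by simpa [eq_comm] using hj)) (by omega)
      have := hsub _ _ hT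
      refine groups {i} T ((Finset.univ \ {i}) \ T) ?_ ?_ Finset.disjoint_sdiff
        (by simpa using hi) hT₁ (by omega)
      · exact Finset.disjoint_sdiff.mono_right hT
      · exact Finset.disjoint_sdiff.mono_right Finset.sdiff_subset
  · push Not at hone
    obtain ⟨T, hT, hT₁, hT₂⟩ := exists_subset_sum_lt_two_mul hL s Finset.univ
      (fun j _ => hone j) (by omega)
    have h₁ := hsub _ _ hT
    obtain ⟨T', hT', hT'₁, hT'₂⟩ := exists_subset_sum_lt_two_mul hL s (Finset.univ \ T)
      (fun j _ => hone j) (by omega)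
    have h₂ := hsub _ _ hT'
    exact groups T T' ((Finset.univ \ T) \ T') (Finset.disjoint_sdiff.mono_right hT')
      (Finset.disjoint_sdiff.mono_right Finset.sdiff_subset) Finset.disjoint_sdiff hT₁ hT'₁
      (by omega)

end DominantColor
-- Relabeling colors and the comparison of the two sets.
section Main

variable {V W K K' : Type*}

/-- The edge uv serves to name an original color: its image in the copy has some color under `C`,
and all other edges share it because `g` separates the colors that occur. -/
lemma hasMonochromaticCopy_of_compRight {C : TopEdgeLabeling V K} {g : K → K'} {H : SimpleGraph W}
    {u v : W} (huv : H.Adj u v) (hg : ∀ e e', g (C e) = g (C e') → C e = C e')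
    (h : HasMonochromaticCopy (C.compRight g) H) : HasMonochromaticCopy C H := by
  obtain ⟨d, ⟨f⟩⟩ := h
  have hf := f.toHom.map_adj huv
  rw [EdgeLabeling.labelGraph_adj] at hf
  obtain ⟨h₁, h₂⟩ := hf
  refine ⟨C ⟨s(f.toHom u, f.toHom v), h₁⟩, IsContained.mono_right ⟨f⟩ fun x y hxy => ?_⟩
  rw [EdgeLabeling.labelGraph_adj] at hxy ⊢
  obtain ⟨h₃, h₄⟩ := hxy
  exact ⟨h₃, hg _ _ (h₄.trans h₂.symm)⟩

/-- The `i`-th edge of the path on five vertices. -/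
def pathEdge (i : Fin 4) : (pathGraph 5).edgeSet :=
  ⟨s(i.castSucc, i.succ), by
    rw [mem_edgeSet, pathGraph_adj]
    exact Or.inl rfl⟩

lemma pathEdge_bijective : Function.Bijective pathEdge := by
  constructor
  · intro i j hij
    have := congrArg Subtype.val hij
    revert this
    revert i j
    decide
  · rintro ⟨e, he⟩
    induction e using Sym2.ind with
    | _ x y =>
      have := he
      rw [mem_edgeSet, pathGraph_adj] at this
      rcases this with h | h
      · exact ⟨⟨x, by omega⟩, Subtype.ext (by simp [pathEdge, h])⟩
      · exact ⟨⟨y, by omega⟩, Subtype.ext (Eq.trans (b := s(y, x)) (by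
          simp [pathEdge, h]) Sym2.eq_swap)⟩

lemma not_hasRainbowCopy_compRight {C : TopEdgeLabeling V (Fin 3)} (g : Fin 3 → K) :
    ¬ HasRainbowCopy (C.compRight g) (pathGraph 5) := by
  rintro ⟨f, hf⟩
  have h : Function.Injective fun i : Fin 4 => C (f.toHom.mapEdgeSet (pathEdge i)) := by
    intro i j hij
    exact pathEdge_bijective.1 (hf (congrArg g hij))
  simpa using Fintype.card_le_of_injective _ h

/-- An edge labeling of a complete graph as a function of two vertices. -/
def colorFun [DecidableEq V] (C : TopEdgeLabeling V K) (o : K) (x y : V) : K :=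
  if h : x ≠ y then C.get x y h else o

lemma colorFun_comm [DecidableEq V] (C : TopEdgeLabeling V K) (o : K) (x y : V) :
    colorFun C o x y = colorFun C o y x := by
  by_cases hxy : x = y
  · simp [colorFun, hxy]
  · simp only [colorFun, ne_eq, hxy, Ne.symm hxy, not_false_eq_true, dite_true]
    exact EdgeLabeling.get_comm y x _

lemma colorFun_of_ne [DecidableEq V] (C : TopEdgeLabeling V K) (o : K) {x y : V} (h : x ≠ y) :
    colorFun C o x y = C ⟨s(x, y), h⟩ := dif_pos h

lemma colorGraph_colorFun_le [DecidableEq V] (C : TopEdgeLabeling V K) (o d : K) :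
    colorGraph (colorFun C o) (colorFun_comm C o) d ≤ C.labelGraph d := by
  rintro x y ⟨h₁, h₂⟩
  rw [EdgeLabeling.labelGraph_adj]
  exact ⟨h₁, (colorFun_of_ne C o h₁).symm.trans h₂⟩

lemma rainbowPathFree_colorFun [DecidableEq V] {C : TopEdgeLabeling V K} {o : K}
    (h : ¬ HasRainbowCopy C (pathGraph 5)) : RainbowPathFree (colorFun C o) := by
  intro x₁ x₂ x₃ x₄ x₅ hv H
  apply h
  have hinj : Function.Injective [x₁, x₂, x₃, x₄, x₅].get := List.nodup_iff_injective_get.1 hv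
  have hH : Function.Injective [colorFun C o x₁ x₂, colorFun C o x₂ x₃, colorFun C o x₃ x₄,
    colorFun C o x₄ x₅].get := List.nodup_iff_injective_get.1 H
  refine ⟨⟨⟨[x₁, x₂, x₃, x₄, x₅].get, fun {a b} hab => hinj.ne hab.ne⟩, hinj⟩, ?_⟩
  intro e e' hee
  obtain ⟨i, rfl⟩ := pathEdge_bijective.2 e
  obtain ⟨j, rfl⟩ := pathEdge_bijective.2 e'
  congr 1
  apply hH
  have key : ∀ i : Fin 4, [colorFun C o x₁ x₂, colorFun C o x₂ x₃, colorFun C o x₃ x₄,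
      colorFun C o x₄ x₅].get i = colorFun C o ([x₁, x₂, x₃, x₄, x₅].get i.castSucc)
        ([x₁, x₂, x₃, x₄, x₅].get i.succ) := by
    intro i
    fin_cases i <;> rfl
  rw [key, key, colorFun_of_ne C o (hinj.ne (Fin.castSucc_lt_succ).ne),
    colorFun_of_ne C o (hinj.ne (Fin.castSucc_lt_succ).ne)]
  exact hee

lemma IsBalancedTripartite.exists_edge [Fintype W] {H : SimpleGraph W} {a : ℕ}
    (hH : IsBalancedTripartite H a) : ∃ u v, H.Adj u v := by
  obtain ⟨u⟩ : Nonempty W := Fintype.card_pos_iff.1 (by rw [hH.card_eq]; omega)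
  exact ⟨u, hH.exists_adj u⟩

lemma mem_gallaiRamseySet_of_mem_ramseySet [Fintype W] {H : SimpleGraph W} {m k n a : ℕ}
    (hH : IsBalancedTripartite H a) (hm : 2 ≤ m) (hk : 3 ≤ k)
    (h : n ∈ ramseySet 3 (disjointCopies m H)) :
    n ∈ gallaiRamseySet k (pathGraph 5) (disjointCopies m H) := by
  classical
  intro C
  refine or_iff_not_imp_left.2 fun hno => ?_
  have hR := isThreeRamsey_of_mem_ramseySet h
  have hcard := le_card_of_isThreeRamsey hH (by omega) hR
  have hma : m * 1 ≤ m * a := Nat.mul_le_mul_left _ hH.one_le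
  have e₁ : m * (4 * a + 3) = 4 * (m * a) + 3 * m := by ring
  have e₂ : m * (2 * a + 1) = 2 * (m * a) + m := by ring
  obtain ⟨o⟩ : Nonempty (Fin k) := ⟨⟨0, by omega⟩⟩
  have : Nonempty (Fin n) := ⟨⟨0, by omega⟩⟩
  have hmono : ∀ d, (disjointCopies m H).IsContained
      (colorGraph (colorFun C o) (colorFun_comm C o) d) →
      HasMonochromaticCopy C (disjointCopies m H) :=
    fun d hd => ⟨d, hd.mono_right (colorGraph_colorFun_le C o d)⟩
  have hP := rainbowPathFree_colorFun (o := o) hno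
  by_cases h4 : UsesFourColors (colorFun C o)
  · rcases connectedRainbowFree_or_nearlyMonochromatic (colorFun_comm C o) hP (fun S hS => by
      by_contra! hx
      have := Finset.card_le_card (Finset.subset_iff.2 fun x (_ : x ∈ Finset.univ) => hx x)
      rw [Finset.card_univ, Fintype.card_fin] at this
      omega) with T | ⟨S, d, hS, hd⟩
    · obtain ⟨D, π, hπ⟩ := T.exists_partition h4
      obtain ⟨d, hd⟩ := exists_isContained_of_dominant (hc := colorFun_comm C o) hπ hH hR
        (by omega) (by rwa [Fintype.card_fin])
      exact hmono d hd
    -- The clique must have m(2a+1) vertices. From n ≥ 4ma + 3m - 2 and at most five removed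
    -- vertices this reduces to 2ma + 2m ≥ 7, which is where m ≥ 2 enters.
    · refine hmono d (isContained_of_clique _ (Finset.univ \ S) ?_ fun x hx y hy hxy =>
        ⟨hxy, hd x y (by simpa using hx) (by simpa using hy) hxy⟩)
      have := Finset.le_card_sdiff S Finset.univ
      rw [Fintype.card_prod, Fintype.card_fin, hH.card_eq]
      rw [Finset.card_univ, Fintype.card_fin] at this
      omega
  · simp only [UsesFourColors] at h4
    push Not at h4
    obtain ⟨i, j, l, hl⟩ := h4
    have hC : ∀ e : (⊤ : SimpleGraph (Fin n)).edgeSet, C e = i ∨ C e = j ∨ C e = l := by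
      rintro ⟨e, he⟩
      induction e using Sym2.ind with
      | _ x y =>
        have := hl x y he
        rw [colorFun_of_ne C o he] at this
        tauto
    obtain ⟨u, v, huv⟩ := hH.exists_edge
    refine hasMonochromaticCopy_of_compRight (H := disjointCopies m H)
      (g := fun x => if x = i then (0 : Fin 3) else if x = j then 1 else 2)
      (u := (⟨0, by omega⟩, u)) (v := (⟨0, by omega⟩, v)) ⟨rfl, huv⟩ (fun e e' he => ?_) (h _)
    have h₁ := hC e
    have h₂ := hC e'
    split_ifs at he <;> simp_all

lemma gallaiRamseySet_eq_ramseySet [Fintype W] {H : SimpleGraph W} {m k a : ℕ}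
    (hH : IsBalancedTripartite H a) (hm : 2 ≤ m) (hk : 3 ≤ k) :
    gallaiRamseySet k (pathGraph 5) (disjointCopies m H) = ramseySet 3 (disjointCopies m H) := by
  refine Set.Subset.antisymm (fun n hn C => ?_)
    fun n hn => mem_gallaiRamseySet_of_mem_ramseySet hH hm hk hn
  obtain ⟨u, v, huv⟩ := hH.exists_edge
  refine hasMonochromaticCopy_of_compRight (g := Fin.castLE hk) (H := disjointCopies m H)
    (u := (⟨0, by omega⟩, u)) (v := (⟨0, by omega⟩, v)) ⟨rfl, huv⟩
    (fun e e' he => Fin.castLE_injective hk he) ?_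
  exact (hn (C.compRight (Fin.castLE hk))).resolve_left (not_hasRainbowCopy_compRight _)

lemma isBalancedTripartite_completeGraph_three :
    IsBalancedTripartite (completeGraph (Fin 3)) 1 where
  one_le := le_rfl
  card_eq := rfl
  exists_coloring := ⟨id, fun _ _ h => h, fun j => by
    rw [Nat.card_eq_fintype_card]
    revert j
    decide⟩
  card_le_of_indep := by decide
  exists_adj := by decide

lemma isBalancedTripartite_cycleGraph_five : IsBalancedTripartite (cycleGraph 5) 2 where
  one_le := by norm_num
  card_eq := rfl
  exists_coloring := ⟨![0, 1, 0, 1, 2], by decide, fun j => by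
    rw [Nat.card_eq_fintype_card]
    revert j
    decide⟩
  card_le_of_indep := by decide
  exists_adj := by decide

lemma gallaiRamsey_path_five [Fintype W] {H : SimpleGraph W} {m k a : ℕ}
    (hH : IsBalancedTripartite H a) (hm : 2 ≤ m) (hk : 3 ≤ k) :
    (ramseySet 3 (disjointCopies m H)).Nonempty ∧
      (gallaiRamseySet k (pathGraph 5) (disjointCopies m H)).Nonempty ∧
      gallaiRamseyNumber k (pathGraph 5) (disjointCopies m H) =
        ramseyNumber 3 (disjointCopies m H) := by
  have h := ramseySet_three_nonempty (disjointCopies m H)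
  rw [gallaiRamseyNumber, ramseyNumber, gallaiRamseySet_eq_ramseySet hH hm hk]
  exact ⟨h, h, rfl⟩

end Main
end GallaiRamsey

theorem mainTheorem4 (m k : ℕ) (hm : 2 ≤ m) (hk : 3 ≤ k) :
    ((GallaiRamsey.ramseySet 3
          (GallaiRamsey.disjointCopies m (SimpleGraph.completeGraph (Fin 3)))).Nonempty ∧
      (GallaiRamsey.gallaiRamseySet k (SimpleGraph.pathGraph 5)
          (GallaiRamsey.disjointCopies m (SimpleGraph.completeGraph (Fin 3)))).Nonempty ∧
      GallaiRamsey.gallaiRamseyNumber k (SimpleGraph.pathGraph 5)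
          (GallaiRamsey.disjointCopies m (SimpleGraph.completeGraph (Fin 3))) =
        GallaiRamsey.ramseyNumber 3
          (GallaiRamsey.disjointCopies m (SimpleGraph.completeGraph (Fin 3)))) ∧
    ((GallaiRamsey.ramseySet 3
          (GallaiRamsey.disjointCopies m (SimpleGraph.cycleGraph 5))).Nonempty ∧
      (GallaiRamsey.gallaiRamseySet k (SimpleGraph.pathGraph 5)
          (GallaiRamsey.disjointCopies m (SimpleGraph.cycleGraph 5))).Nonempty ∧
      GallaiRamsey.gallaiRamseyNumber k (SimpleGraph.pathGraph 5)
          (GallaiRamsey.disjointCopies m (SimpleGraph.cycleGraph 5)) =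
        GallaiRamsey.ramseyNumber 3
          (GallaiRamsey.disjointCopies m (SimpleGraph.cycleGraph 5))) :=
  ⟨GallaiRamsey.gallaiRamsey_path_five
      GallaiRamsey.isBalancedTripartite_completeGraph_three hm hk,
    GallaiRamsey.gallaiRamsey_path_five
      GallaiRamsey.isBalancedTripartite_cycleGraph_five hm hk⟩
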